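/- All rings are commutative with identity, and ring homomorphisms preserve the identity. Let $C$ be a commutative ring and fix $\lambda\in C$. A Baxter $C$-algebra of weight $\lambda$ is a pair $(R,P)$ of a commutative $C$-algebra $R$ and a $C$-linear map $P:R\to R$ with $P(x)P(y)=P(xP(y))+P(yP(x))+\lambda P(xy)$ for all $x,y\in R$; its homomorphisms are the $C$-algebra homomorphisms that commute with the operators. Let $\mathbf{Alg}_C$ be the category of commutative $C$-algebras and $\mathbf{Bax}_{C}$ the category of Baxter $C$-algebras of weight $\lambda$. For a commutative $C$-algebra $A$, let $Ш_C(A)=\bigoplus_{k\ge 0}A^{\otimes(k+1)}$ (tensor powers over $C$) with the mixable shuffle product $$(x_0\otimes x_1\otimes\cdots\otimes x_m)(y_0\otimes y_1\otimes\cdots\otimes y_n)=\sum_{(\sigma,T)}\lambda^{|T|}\,x_0y_0\otimes\sigma(x^+\otimes y^+;T).$$ Here $\sigma$ runs over the permutations of $\{1,\dots,m+n\}$ with $\sigma^{-1}(1)<\cdots<\sigma^{-1}(m)$ and $\sigma^{-1}(m+1)<\cdots<\sigma^{-1}(m+n)$, $T$ runs over the sets of pairs $(k,k+1)$ with $\sigma(k)\le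 m<\sigma(k+1)$, and, with $(u_1,\dots,u_{m+n})=(x_1,\dots,x_m,y_1,\dots,y_n)$, $\sigma(x^+\otimes y^+;T)$ is obtained from $u_{\sigma(1)}\otimes\cdots\otimes u_{\sigma(m+n)}$ by multiplying the $k$-th and $(k+1)$-st factors for every $(k,k+1)\in T$. With the operator $P_A(x_0\otimes\cdots\otimes x_k)=1\otimes x_0\otimes\cdots\otimes x_k$, this is a Baxter $C$-algebra of weight $\lambda$, and $A\mapsto(Ш_C(A),P_A)$, $f\mapsto Ш_C(f)=\bigoplus_{k\ge 0} f^{\otimes(k+1)}$ is a functor $\mathbf{Alg}_C\to\mathbf{Bax}_{C}$. Let $\Lambda$ be a small category and $F:\Lambda\to\mathbf{Alg}_C$, $i\mapsto A_i$, a functor. Then the colimit of $i\mapsto(Ш_C(A_i),P_{A_i})$ exists in $\mathbf{Bax}_{C}$ and $$\operatorname{colim}_i\,(Ш_C(A_i),P_{A_i})\cong\bigl(Ш_C(\operatorname{colim}_iA_i),P_{\operatorname{colim}_iA_i}\bigr)$$ by an isomorphism compatible with the canonical maps from the $(Ш_C(A_i),P_{A_i})$. That is, $Ш_C$ carries every colimit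 cocone of $F$ to a colimit cocone. In particular, for all commutative $C$-algebras $A$ and $B$, $Ш_C(A\otimes_C B)$, with the maps induced by $a\mapsto a\otimes 1$ and $b\mapsto 1\otimes b$, is the coproduct of $Ш_C(A)$ and $Ш_C(B)$ in $\mathbf{Bax}_{C}$. -/

import Mathlib

open CategoryTheory Limits TensorProduct DirectSum

universe u v

noncomputable section

namespace Baxter

section Words

variable (C : Type u) [CommRing C] (A : Type v) [CommRing A] [Algebra C A]

/-- The module of words `⨁_{k ≥ 0} A^{⊗ k}`. -/
abbrev Words : Type (max u v) := ⨁ k : ℕ, ⨂[C]^k A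

variable {A}

/-- The bilinear map `A × A^{⊗ n} → A^{⊗ (n+1)}`, `(a, w) ↦ a ⊗ w`. -/
def consPow (n : ℕ) : A →ₗ[C] (⨂[C]^n A) →ₗ[C] ⨂[C]^(n + 1) A :=
  (PiTensorProduct.lift (R := C) (s := fun _ : Fin n => A)).toLinearMap ∘ₗ
    (PiTensorProduct.tprod C (s := fun _ : Fin (n + 1) => A)).curryLeft

theorem consPow_tprod (n : ℕ) (a : A) (x : Fin n → A) :
    consPow C n a (PiTensorProduct.tprod C x) =
      PiTensorProduct.tprod C (Fin.cons a x : Fin (n + 1) → A) := by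
  simp [consPow]

/-- The linear map on `A^{⊗ (n+1)}` given by `a ⊗ w ↦ f a w`, for a bilinear map `f` on
`A × A^{⊗ n}`. -/
def uncons {M : Type*} [AddCommGroup M] [Module C M] (n : ℕ) :
    (A →ₗ[C] (⨂[C]^n A) →ₗ[C] M) →ₗ[C] (⨂[C]^(n + 1) A) →ₗ[C] M :=
  (PiTensorProduct.lift (R := C) (s := fun _ : Fin (n + 1) => A)).toLinearMap ∘ₗ
    (multilinearCurryLeftEquiv C (fun _ : Fin (n + 1) => A) M).symm.toLinearMap ∘ₗ
    (LinearMap.compRight C (PiTensorProduct.lift (R := C) (s := fun _ : Fin n => A)).symm.toLinearMap)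

theorem uncons_consPow {M : Type*} [AddCommGroup M] [Module C M] (n : ℕ)
    (f : A →ₗ[C] (⨂[C]^n A) →ₗ[C] M) (a : A) (w : ⨂[C]^n A) :
    uncons C n f (consPow C n a w) = f a w := by
  have : uncons C n f ∘ₗ consPow C n a = f a := by
    apply PiTensorProduct.ext
    ext x
    simp only [uncons, LinearMap.compMultilinearMap_apply, LinearMap.comp_apply, consPow_tprod,
      LinearEquiv.coe_coe, PiTensorProduct.lift.tprod]
    rfl
  exact LinearMap.congr_fun this w

theorem tprod_succ (n : ℕ) (x : Fin (n + 1) → A) :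
    PiTensorProduct.tprod C x = consPow C n (x 0) (PiTensorProduct.tprod C (Fin.tail x)) := by
  rw [consPow_tprod, Fin.cons_self_tail]

/-- Prepending a letter to a word. -/
def cons : A →ₗ[C] Words C A →ₗ[C] Words C A :=
  LinearMap.flip (DirectSum.toModule C ℕ _ fun n =>
    ((consPow C n).compr₂ (DirectSum.lof C ℕ (fun k => ⨂[C]^k A) (n + 1))).flip)

theorem cons_lof (n : ℕ) (a : A) (w : ⨂[C]^n A) :
    cons C a (DirectSum.lof C ℕ (fun k => ⨂[C]^k A) n w) =
      DirectSum.lof C ℕ (fun k => ⨂[C]^k A) (n + 1) (consPow C n a w) := by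
  simp [cons]

variable (A) in
/-- The empty word. -/
def emptyWord : Words C A :=
  DirectSum.lof C ℕ (fun k => ⨂[C]^k A) 0 (PiTensorProduct.tprod C Fin.elim0)

/-- The pure tensor `x₁ ⊗ ⋯ ⊗ xₙ`, for a list of letters. -/
def word : List A → Words C A
  | [] => emptyWord C A
  | a :: l => cons C a (word l)

theorem word_ofFn (n : ℕ) (x : Fin n → A) :
    word C (List.ofFn x) =
      DirectSum.lof C ℕ (fun k => ⨂[C]^k A) n (PiTensorProduct.tprod C x) := by
  induction n with
  | zero =>
    simp only [List.ofFn_zero, word, emptyWord]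
    congr 2
    exact Subsingleton.elim _ _
  | succ n ih =>
    rw [List.ofFn_succ, word, ih, cons_lof, tprod_succ C n x]
    rfl

theorem words_hom_ext {M : Type*} [AddCommGroup M] [Module C M] {f g : Words C A →ₗ[C] M}
    (h : ∀ l, f (word C l) = g (word C l)) : f = g := by
  apply DirectSum.linearMap_ext
  intro n
  apply PiTensorProduct.ext
  ext x
  have := h (List.ofFn x)
  rw [word_ofFn] at this
  exact this

/-- Components of the mixable shuffle product of `x₁ ⊗ ⋯ ⊗ xₘ` and `y₁ ⊗ ⋯ ⊗ yₙ`, sorted by the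
first letter of the result, which is `x₁`, or `y₁`, or (with coefficient the weight) `x₁ y₁`. -/
def shufflePow (wt : C) : (m n : ℕ) → (⨂[C]^m A) →ₗ[C] (⨂[C]^n A) →ₗ[C] Words C A
  | 0, n => (LinearMap.lsmul C ((⨂[C]^n A) →ₗ[C] Words C A)).flip
      (DirectSum.lof C ℕ (fun k => ⨂[C]^k A) n) ∘ₗ
      (PiTensorProduct.isEmptyEquiv (R := C) (s := fun _ : Fin 0 => A) (Fin 0)).toLinearMap
  | m + 1, 0 => ((LinearMap.lsmul C ((⨂[C]^(m + 1) A) →ₗ[C] Words C A)).flip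
      (DirectSum.lof C ℕ (fun k => ⨂[C]^k A) (m + 1)) ∘ₗ
      (PiTensorProduct.isEmptyEquiv (R := C) (s := fun _ : Fin 0 => A) (Fin 0)).toLinearMap).flip
  | m + 1, n + 1 =>
      uncons C m (LinearMap.mk₂ C (fun a u => cons C a ∘ₗ shufflePow wt m (n + 1) u)
        (by intros; ext; simp) (by intros; ext; simp) (by intros; ext; simp)
        (by intros; ext; simp)) +
      (uncons C n (LinearMap.mk₂ C (fun b v => cons C b ∘ₗ (shufflePow wt (m + 1) n).flip v)
        (by intros; ext; simp) (by intros; ext; simp) (by intros; ext; simp)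
        (by intros; ext; simp))).flip +
      wt • uncons C m (LinearMap.mk₂ C (fun a u => uncons C n
          ((cons C ∘ₗ LinearMap.mulLeft C a).compl₂ (shufflePow wt m n u)))
        (by intros; rw [← map_add]; congr 1; ext; simp [add_mul])
        (by intros; rw [← map_smul]; congr 1; ext; simp)
        (by intros; rw [← map_add]; congr 1; ext; simp)
        (by intros; rw [← map_smul]; congr 1; ext; simp))
  termination_by m n => (m, n)

variable (A) in
/-- The mixable shuffle product of words, as a bilinear map. -/
def shuffle (wt : C) : Words C A →ₗ[C] Words C A →ₗ[C] Words C A :=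
  DirectSum.toModule C ℕ _ fun m => LinearMap.flip <|
    DirectSum.toModule C ℕ _ fun n => (shufflePow C wt m n).flip

theorem shuffle_lof (wt : C) (m n : ℕ) (u : ⨂[C]^m A) (v : ⨂[C]^n A) :
    shuffle C A wt (DirectSum.lof C ℕ (fun k => ⨂[C]^k A) m u)
      (DirectSum.lof C ℕ (fun k => ⨂[C]^k A) n v) = shufflePow C wt m n u v := by
  simp [shuffle]

theorem emptyWord_shuffle (wt : C) (w : Words C A) : shuffle C A wt (emptyWord C A) w = w := by
  suffices h : shuffle C A wt (emptyWord C A) = LinearMap.id from LinearMap.congr_fun h w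
  apply DirectSum.linearMap_ext
  intro n
  refine LinearMap.ext fun v => ?_
  simp only [LinearMap.comp_apply, emptyWord, shuffle_lof, shufflePow]
  simp

theorem shuffle_emptyWord (wt : C) (w : Words C A) : shuffle C A wt w (emptyWord C A) = w := by
  suffices h : (shuffle C A wt).flip (emptyWord C A) = LinearMap.id from LinearMap.congr_fun h w
  apply DirectSum.linearMap_ext
  intro n
  refine LinearMap.ext fun v => ?_
  cases n with
  | zero =>
    simp only [LinearMap.comp_apply, LinearMap.flip_apply, emptyWord, shuffle_lof, shufflePow]
    simp only [LinearMap.lsmul_apply, LinearMap.smul_apply, LinearMap.id_apply, LinearEquiv.coe_coe]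
    rw [← map_smul]
    congr 1
    apply (PiTensorProduct.isEmptyEquiv (R := C) (s := fun _ : Fin 0 => A) (Fin 0)).injective
    simp
  | succ n =>
    simp only [LinearMap.comp_apply, LinearMap.flip_apply, emptyWord, shuffle_lof, shufflePow]
    simp

theorem cons_shuffle_cons (wt : C) (a b : A) (u v : Words C A) :
    shuffle C A wt (cons C a u) (cons C b v) =
      cons C a (shuffle C A wt u (cons C b v)) + cons C b (shuffle C A wt (cons C a u) v) +
        wt • cons C (a * b) (shuffle C A wt u v) := by
  induction u using DirectSum.induction_on with
  | zero => simp
  | add x y hx hy => simp only [map_add, LinearMap.add_apply, hx, hy, smul_add]; abel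
  | of m u =>
    induction v using DirectSum.induction_on with
    | zero => simp
    | add x y hx hy => simp only [map_add, hx, hy, smul_add]; abel
    | of n v =>
      change shuffle C A wt (cons C a (DirectSum.lof C ℕ (fun k => ⨂[C]^k A) m u))
        (cons C b (DirectSum.lof C ℕ (fun k => ⨂[C]^k A) n v)) =
        cons C a (shuffle C A wt (DirectSum.lof C ℕ (fun k => ⨂[C]^k A) m u)
          (cons C b (DirectSum.lof C ℕ (fun k => ⨂[C]^k A) n v))) +
        cons C b (shuffle C A wt (cons C a (DirectSum.lof C ℕ (fun k => ⨂[C]^k A) m u))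
          (DirectSum.lof C ℕ (fun k => ⨂[C]^k A) n v)) +
        wt • cons C (a * b) (shuffle C A wt (DirectSum.lof C ℕ (fun k => ⨂[C]^k A) m u)
          (DirectSum.lof C ℕ (fun k => ⨂[C]^k A) n v))
      simp only [cons_lof, shuffle_lof]
      conv_lhs => rw [shufflePow]
      simp only [LinearMap.add_apply, LinearMap.smul_apply, LinearMap.flip_apply, uncons_consPow,
        LinearMap.mk₂_apply, LinearMap.comp_apply, LinearMap.compl₂_apply,
        LinearMap.mulLeft_apply]

/-- A linear condition on a word may be checked on pure tensors. -/
theorem words_induction {p : Words C A → Prop} (w : Words C A) (hw : ∀ l, p (word C l))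
    (hadd : ∀ u v, p u → p v → p (u + v)) (hsmul : ∀ (c : C) u, p u → p (c • u)) : p w := by
  have h0 : p 0 := by simpa using hsmul 0 _ (hw [])
  induction w using DirectSum.induction_on with
  | zero => exact h0
  | add x y hx hy => exact hadd _ _ hx hy
  | of n w =>
    change p (DirectSum.lof C ℕ (fun k => ⨂[C]^k A) n w)
    induction w using PiTensorProduct.induction_on with
    | smul_tprod r f => rw [map_smul, ← word_ofFn]; exact hsmul _ _ (hw _)
    | add x y hx hy => rw [map_add]; exact hadd _ _ hx hy

theorem shuffle_comm_word (wt : C) : ∀ k l : List A,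
    shuffle C A wt (word C k) (word C l) = shuffle C A wt (word C l) (word C k)
  | [], l => by rw [word, emptyWord_shuffle, shuffle_emptyWord]
  | _ :: _, [] => by rw [word.eq_1 C, emptyWord_shuffle, shuffle_emptyWord]
  | a :: k, b :: l => by
    have h1 := shuffle_comm_word wt k (b :: l)
    have h2 := shuffle_comm_word wt (a :: k) l
    have h3 := shuffle_comm_word wt k l
    simp only [word] at h1 h2 ⊢
    rw [cons_shuffle_cons, cons_shuffle_cons, h1, h2, h3, mul_comm a b]
    abel
  termination_by k l => k.length + l.length

theorem shuffle_comm (wt : C) (u v : Words C A) : shuffle C A wt u v = shuffle C A wt v u := by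
  induction u using words_induction with
  | hw k =>
    induction v using words_induction with
    | hw l => exact shuffle_comm_word C wt k l
    | hadd u v hu hv => simp [hu, hv]
    | hsmul c u hu => simp [hu]
  | hadd u v hu hv => simp [hu, hv]
  | hsmul c u hu => simp [hu]

theorem shuffle_assoc_word (wt : C) : ∀ k l m : List A,
    shuffle C A wt (shuffle C A wt (word C k) (word C l)) (word C m) =
      shuffle C A wt (word C k) (shuffle C A wt (word C l) (word C m))
  | [], l, m => by rw [word, emptyWord_shuffle, emptyWord_shuffle]
  | _ :: _, [], m => by rw [word.eq_1 C, emptyWord_shuffle, shuffle_emptyWord]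
  | _ :: _, _ :: _, [] => by rw [word.eq_1 C, shuffle_emptyWord, shuffle_emptyWord]
  | a :: k, b :: l, c :: m => by
    have h1 := shuffle_assoc_word wt k (b :: l) (c :: m)
    have h2 := shuffle_assoc_word wt (a :: k) l (c :: m)
    have h3 := shuffle_assoc_word wt (a :: k) (b :: l) m
    have h4 := shuffle_assoc_word wt k l (c :: m)
    have h5 := shuffle_assoc_word wt k (b :: l) m
    have h6 := shuffle_assoc_word wt (a :: k) l m
    have h7 := shuffle_assoc_word wt k l m
    simp only [word] at h1 h2 h3 h4 h5 h6 ⊢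
    have e1 := congrArg (cons C a) h1
    have e2 := congrArg (cons C b) h2
    have e3 := congrArg (cons C c) h3
    have e4 := congrArg (cons C (a * b)) h4
    have e5 := congrArg (cons C (a * c)) h5
    have e6 := congrArg (cons C (b * c)) h6
    have e7 := congrArg (cons C (a * (b * c))) h7
    simp only [cons_shuffle_cons, map_add, map_smul, LinearMap.add_apply, LinearMap.smul_apply,
      mul_assoc] at e1 e2 e3 e4 e5 e6 e7 ⊢
    linear_combination (norm := module) e1 + e2 + e3 + wt • e4 + wt • e5 + wt • e6 + (wt * wt) • e7
  termination_by k l m => k.length + l.length + m.length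

theorem shuffle_assoc (wt : C) (u v w : Words C A) :
    shuffle C A wt (shuffle C A wt u v) w = shuffle C A wt u (shuffle C A wt v w) := by
  induction u using words_induction with
  | hw k =>
    induction v using words_induction with
    | hw l =>
      induction w using words_induction with
      | hw m => exact shuffle_assoc_word C wt k l m
      | hadd u v hu hv => simp only [map_add, hu, hv]
      | hsmul c u hu => simp only [map_smul, hu]
    | hadd u v hu hv => simp only [map_add, LinearMap.add_apply, hu, hv]
    | hsmul c u hu => simp only [map_smul, LinearMap.smul_apply, hu]
  | hadd u v hu hv => simp only [map_add, LinearMap.add_apply, hu, hv]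
  | hsmul c u hu => simp only [map_smul, LinearMap.smul_apply, hu]

end Words

section MixableShuffles

/-- `(m,n)`-shuffles: permutations `σ` with `σ⁻¹(1) < ⋯ < σ⁻¹(m)` and
`σ⁻¹(m+1) < ⋯ < σ⁻¹(m+n)` (indices here start from `0`). -/
def IsShuffle (m n : ℕ) (σ : Equiv.Perm (Fin (m + n))) : Prop :=
  StrictMono (fun i : Fin m => σ.symm (Fin.castAdd n i)) ∧
    StrictMono (fun j : Fin n => σ.symm (Fin.natAdd m j))

open scoped Classical in
/-- The finite set of `(m,n)`-shuffles. -/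
def shuffles (m n : ℕ) : Finset (Equiv.Perm (Fin (m + n))) :=
  Finset.univ.filter (IsShuffle m n)

open scoped Classical in
/-- The admissible pairs `(k, k+1)` of `σ`, those with `σ(k) ≤ m < σ(k+1)`, represented by `k`
(indices here start from `0`, so that the condition reads `σ(k) < m ≤ σ(k+1)`). -/
def admissible (m n : ℕ) (σ : Equiv.Perm (Fin (m + n))) : Finset ℕ :=
  (Finset.range (m + n)).filter fun k =>
    ∃ h : k + 1 < m + n, (σ ⟨k, Nat.lt_of_succ_lt h⟩ : ℕ) < m ∧ m ≤ (σ ⟨k + 1, h⟩ : ℕ)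

/-- The list of tensor factors of `u₀ ⊗̂ u₁ ⊗̂ ⋯`, where the `i`-th and the `(i+1)`-st entry are
multiplied if `i ∈ T`. The second argument is the position of the first entry of the list. -/
def contract {A : Type v} [Mul A] (T : Finset ℕ) : ℕ → List A → List A
  | _, [] => []
  | _, [a] => [a]
  | k, a :: b :: l => if k ∈ T then contract T (k + 1) (a * b :: l)
      else a :: contract T (k + 1) (b :: l)
  termination_by _ l => l.length

theorem contract_of_notMem {A : Type v} [Mul A] {T : Finset ℕ} {k : ℕ} (hk : k ∉ T) (a : A)
    (l : List A) : contract T k (a :: l) = a :: contract T (k + 1) l := by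
  cases l with
  | nil => simp [contract]
  | cons b l => simp [contract, hk]

theorem contract_congr {A : Type v} [Mul A] {S T : Finset ℕ} :
    ∀ (k : ℕ) (l : List A), (∀ i, k ≤ i → (i ∈ S ↔ i ∈ T)) → contract S k l = contract T k l
  | _, [], _ => by simp [contract]
  | _, [a], _ => by simp [contract]
  | k, a :: b :: l, h => by
    have h' : ∀ i, k + 1 ≤ i → (i ∈ S ↔ i ∈ T) := fun i hi => h i (by omega)
    rw [contract, contract, contract_congr (k + 1) (a * b :: l) h',
      contract_congr (k + 1) (b :: l) h']
    simp only [h k le_rfl]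
  termination_by _ l => l.length

/-- Positions of the admissible pairs in a list of letters, where the letters below `m` belong to
the first word. -/
def admList (m : ℕ) : ℕ → List ℕ → Finset ℕ
  | _, [] => ∅
  | _, [_] => ∅
  | k, a :: b :: w => if a < m ∧ m ≤ b then insert k (admList m (k + 1) (b :: w))
      else admList m (k + 1) (b :: w)

theorem mem_admList (m : ℕ) : ∀ (k : ℕ) (w : List ℕ) (i : ℕ), i ∈ admList m k w ↔
    k ≤ i ∧ ∃ h : i - k + 1 < w.length, w[i - k] < m ∧ m ≤ w[i - k + 1]
  | k, [], i => by simp [admList]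
  | k, [a], i => by simp [admList]
  | k, a :: b :: w, i => by
    have ih := mem_admList m (k + 1) (b :: w) i
    rcases lt_trichotomy i k with h | rfl | h
    · rw [admList]
      split_ifs
      · rw [Finset.mem_insert, ih]
        constructor
        · rintro (h' | h') <;> omega
        · rintro ⟨h', -⟩; omega
      · rw [ih]
        constructor
        · rintro h'; omega
        · rintro ⟨h', -⟩; omega
    · rw [admList]
      split_ifs with hab
      · simp [hab]
      · rw [ih]
        simp
        simpa using hab
    · obtain ⟨j, rfl⟩ : ∃ j, i = k + 1 + j := ⟨i - (k + 1), by omega⟩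
      have e1 : k + 1 + j - (k + 1) = j := by omega
      have e2 : k + 1 + j - k = j + 1 := by omega
      rw [admList]
      simp only [e1, e2, List.length_cons, List.getElem_cons_succ] at ih ⊢
      split_ifs with hab
      · rw [Finset.mem_insert, ih]
        constructor
        · rintro (h' | ⟨-, h1, h2⟩)
          · omega
          · exact ⟨by omega, by omega, h2⟩
        · rintro ⟨-, h1, h2⟩
          exact Or.inr ⟨by omega, by omega, h2⟩
      · rw [ih]
        constructor
        · rintro ⟨-, h1, h2⟩
          exact ⟨by omega, by omega, h2⟩
        · rintro ⟨-, h1, h2⟩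
          exact ⟨by omega, by omega, h2⟩

/-- All interleavings of two lists. -/
def interleavings : List ℕ → List ℕ → List (List ℕ)
  | [], l => [l]
  | a :: k, [] => [a :: k]
  | a :: k, b :: l => (interleavings k (b :: l)).map (a :: ·) ++
      (interleavings (a :: k) l).map (b :: ·)
  termination_by k l => k.length + l.length

theorem mem_interleavings (m : ℕ) : ∀ (k l w : List ℕ), (∀ a ∈ k, a < m) → (∀ b ∈ l, m ≤ b) →
    (w ∈ interleavings k l ↔ w.filter (· < m) = k ∧ w.filter (m ≤ ·) = l)
  | [], l, w, _, hl => by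
    simp only [interleavings, List.mem_singleton, List.filter_eq_nil_iff]
    constructor
    · rintro rfl
      refine ⟨fun a ha => by simpa using hl a ha, ?_⟩
      rw [List.filter_eq_self]
      simpa using hl
    · rintro ⟨h1, h2⟩
      rw [← h2, eq_comm, List.filter_eq_self]
      simpa using h1
  | a :: k, [], w, hk, _ => by
    simp only [interleavings, List.mem_singleton, List.filter_eq_nil_iff]
    constructor
    · rintro rfl
      refine ⟨?_, fun a ha => by simpa using hk a ha⟩
      rw [List.filter_eq_self]
      simpa using hk
    · rintro ⟨h1, h2⟩
      rw [← h1, eq_comm, List.filter_eq_self]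
      simpa using h2
  | a :: k, b :: l, w, hk, hl => by
    have ha : a < m := hk a (by simp)
    have hb : m ≤ b := hl b (by simp)
    have h1 := fun w => mem_interleavings m k (b :: l) w (fun x hx => hk x (by simp [hx])) hl
    have h2 := fun w => mem_interleavings m (a :: k) l w hk (fun x hx => hl x (by simp [hx]))
    simp only [interleavings, List.mem_append, List.mem_map, h1, h2]
    constructor
    · rintro (⟨w, ⟨h, h'⟩, rfl⟩ | ⟨w, ⟨h, h'⟩, rfl⟩)
      · simp [ha, h, h', ha.not_ge]
      · simp [h, h', hb, hb.not_gt]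
    · rintro ⟨h, h'⟩
      cases w with
      | nil => simp at h
      | cons c w =>
        rcases lt_or_ge c m with hc | hc
        · simp [hc, hc.not_ge] at h h'
          exact Or.inl ⟨w, ⟨h.2, h'⟩, by rw [h.1]⟩
        · simp [hc, hc.not_gt] at h h'
          exact Or.inr ⟨w, ⟨h, h'.2⟩, by rw [h'.1]⟩
  termination_by k l => k.length + l.length

theorem nodup_interleavings (m : ℕ) : ∀ (k l : List ℕ), (∀ a ∈ k, a < m) → (∀ b ∈ l, m ≤ b) →
    (interleavings k l).Nodup
  | [], l, _, _ => by simp [interleavings]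
  | a :: k, [], _, _ => by simp [interleavings]
  | a :: k, b :: l, hk, hl => by
    have ha : a < m := hk a (by simp)
    have hb : m ≤ b := hl b (by simp)
    have h1 := nodup_interleavings m k (b :: l) (fun x hx => hk x (by simp [hx])) hl
    have h2 := nodup_interleavings m (a :: k) l hk (fun x hx => hl x (by simp [hx]))
    rw [interleavings, List.nodup_append]
    refine ⟨h1.map fun _ _ h => by simpa using h, h2.map fun _ _ h => by simpa using h, ?_⟩
    rintro x hx y hy rfl
    simp only [List.mem_map] at hx hy
    obtain ⟨w, -, rfl⟩ := hx
    obtain ⟨w', -, h⟩ := hy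
    simp only [List.cons.injEq] at h
    omega
  termination_by k l => k.length + l.length

theorem isShuffle_iff (m n : ℕ) (σ : Equiv.Perm (Fin (m + n))) :
    IsShuffle m n σ ↔
      (List.ofFn fun k => (σ k : ℕ)) ∈ interleavings (List.range m) (List.range' m n) := by
  rw [mem_interleavings m _ _ _ (by simp) (by simp +contextual)]
  have hnd : (List.ofFn fun k => (σ k : ℕ)).Nodup :=
    List.nodup_ofFn.2 fun i j h => σ.injective (Fin.ext h)
  have hmem : ∀ x, x ∈ (List.ofFn fun k => (σ k : ℕ)) ↔ x < m + n := by
    intro x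
    rw [List.mem_ofFn]
    constructor
    · rintro ⟨k, rfl⟩; exact (σ k).2
    · intro hx; exact ⟨σ.symm ⟨x, hx⟩, by simp⟩
  have p1 : ((List.ofFn fun k => (σ k : ℕ)).filter (· < m)).Perm (List.range m) := by
    rw [List.perm_ext_iff_of_nodup (hnd.filter _) List.nodup_range]
    intro x
    simp only [List.mem_filter, hmem, List.mem_range, decide_eq_true_eq]
    omega
  have p2 : ((List.ofFn fun k => (σ k : ℕ)).filter (m ≤ ·)).Perm (List.range' m n) := by
    rw [List.perm_ext_iff_of_nodup (hnd.filter _) List.nodup_range']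
    intro x
    simp only [List.mem_filter, hmem, List.mem_range'_1, decide_eq_true_eq]
    omega
  have q1 : (List.ofFn fun k => (σ k : ℕ)).filter (· < m) = List.range m ↔
      ((List.ofFn fun k => (σ k : ℕ)).filter (· < m)).Pairwise (· < ·) :=
    ⟨fun h => by rw [h]; exact List.pairwise_lt_range,
      fun h => p1.eq_of_pairwise (fun _ _ _ _ h h' => absurd h' (lt_asymm h)) h
        List.pairwise_lt_range⟩
  have q2 : (List.ofFn fun k => (σ k : ℕ)).filter (m ≤ ·) = List.range' m n ↔
      ((List.ofFn fun k => (σ k : ℕ)).filter (m ≤ ·)).Pairwise (· < ·) :=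
    ⟨fun h => by rw [h]; exact List.pairwise_lt_range',
      fun h => p2.eq_of_pairwise (fun _ _ _ _ h h' => absurd h' (lt_asymm h)) h
        List.pairwise_lt_range'⟩
  rw [q1, q2, List.pairwise_filter, List.pairwise_filter, List.pairwise_ofFn, List.pairwise_ofFn,
    IsShuffle]
  simp only [decide_eq_true_eq]
  refine and_congr ⟨fun h i j hij hi hj => ?_, fun h i j hij => ?_⟩
    ⟨fun h i j hij hi hj => ?_, fun h i j hij => ?_⟩
  · by_contra hlt
    have := h.monotone (a := ⟨σ j, hj⟩) (b := ⟨σ i, hi⟩) (by simpa using hlt)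
    have e1 : Fin.castAdd n ⟨σ j, hj⟩ = σ j := rfl
    have e2 : Fin.castAdd n ⟨σ i, hi⟩ = σ i := rfl
    simp only [e1, e2, Equiv.symm_apply_apply] at this
    exact absurd hij this.not_gt
  · by_contra hlt
    have hne : σ.symm (Fin.castAdd n j) ≠ σ.symm (Fin.castAdd n i) := by
      simpa using hij.ne'
    have := h (lt_of_le_of_ne (not_lt.1 hlt) hne) (by simp) (by simp)
    simp only [Equiv.apply_symm_apply, Fin.val_castAdd] at this
    exact absurd hij (by simpa using this.le)
  · by_contra hlt
    have hi' : (σ i : ℕ) - m < n := by have := (σ i).2; omega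
    have hj' : (σ j : ℕ) - m < n := by have := (σ j).2; omega
    have := h.monotone (a := ⟨σ j - m, hj'⟩) (b := ⟨σ i - m, hi'⟩)
      (Fin.mk_le_mk.2 (by omega))
    have e1 : Fin.natAdd m ⟨σ j - m, hj'⟩ = σ j := Fin.ext (by simp; omega)
    have e2 : Fin.natAdd m ⟨σ i - m, hi'⟩ = σ i := Fin.ext (by simp; omega)
    simp only [e1, e2, Equiv.symm_apply_apply] at this
    exact absurd hij this.not_gt
  · by_contra hlt
    have hne : σ.symm (Fin.natAdd m j) ≠ σ.symm (Fin.natAdd m i) := by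
      simpa using hij.ne'
    have := h (lt_of_le_of_ne (not_lt.1 hlt) hne) (by simp) (by simp)
    simp only [Equiv.apply_symm_apply, Fin.val_natAdd] at this
    have hij' : (i : ℕ) < j := hij
    omega

theorem sum_shuffles (m n : ℕ) {M : Type*} [AddCommMonoid M] (g : List ℕ → M) :
    ∑ σ ∈ shuffles m n, g (List.ofFn fun k => (σ k : ℕ)) =
      ((interleavings (List.range m) (List.range' m n)).map g).sum := by
  rw [← List.sum_toFinset _ (nodup_interleavings m _ _ (by simp) (by simp +contextual))]
  refine Finset.sum_nbij (fun σ => List.ofFn fun k => (σ k : ℕ)) ?_ ?_ ?_ fun _ _ => rfl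
  · intro σ hσ
    simp only [shuffles, Finset.mem_filter, Finset.mem_univ, true_and] at hσ
    rw [List.mem_toFinset, ← isShuffle_iff]
    exact hσ
  · intro σ _ τ _ h
    have h' := List.ofFn_injective h
    ext k
    exact congrFun h' k
  · intro w hw
    rw [List.coe_toFinset, Set.mem_ofPred_eq] at hw
    have hw' := hw
    rw [mem_interleavings m _ _ _ (by simp) (by simp +contextual)] at hw'
    have hp : w.Perm (List.range m ++ List.range' m n) := by
      rw [← hw'.1, ← hw'.2]
      have := List.filter_append_perm (· < m) w
      have e : (fun x => decide (m ≤ x)) = fun x : ℕ => !decide (x < m) := by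
        funext x; rw [← decide_not]; simp only [not_lt]
      rw [e]
      exact this.symm
    have hnd : w.Nodup := by
      rw [hp.nodup_iff, List.nodup_append]
      refine ⟨List.nodup_range, List.nodup_range', ?_⟩
      intro a ha b hb
      simp at ha hb
      omega
    have hlen : w.length = m + n := by simpa using hp.length_eq
    have hlt : ∀ x ∈ w, x < m + n := by
      intro x hx
      rw [hp.mem_iff] at hx
      simp at hx
      omega
    let f : Fin (m + n) → Fin (m + n) := fun k =>
      ⟨w[(k : ℕ)]'(by omega), hlt _ (List.getElem_mem _)⟩
    have hf : Function.Injective f := by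
      intro i j hij
      have := congrArg Fin.val hij
      exact Fin.ext ((hnd.getElem_inj_iff).1 this)
    let σ : Equiv.Perm (Fin (m + n)) := Equiv.ofBijective f (Finite.injective_iff_bijective.1 hf)
    have hσ : (List.ofFn fun k => (σ k : ℕ)) = w := by
      apply List.ext_getElem
      · simp [hlen]
      · intro i h1 h2
        simp [σ, f]
    refine ⟨σ, ?_, hσ⟩
    simp only [shuffles, Finset.coe_filter, Finset.mem_univ, true_and, Set.mem_ofPred_eq]
    rw [isShuffle_iff, hσ]
    exact hw

variable (C : Type u) [CommRing C] (wt : C) {A : Type v} [CommRing A] [Algebra C A]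

/-- The sum of the mixable shuffles with a given underlying list of letters. -/
def mixSum (x : ℕ → A) (m k : ℕ) (w : List ℕ) : Words C A :=
  ∑ T ∈ (admList m k w).powerset, wt ^ T.card • word C (contract T k (w.map x))

theorem mixSum_nil (x : ℕ → A) (m k : ℕ) : mixSum C wt x m k [] = emptyWord C A := by
  simp [mixSum, admList, contract, word]

theorem notMem_of_subset_admList {m k i : ℕ} {w : List ℕ} {T : Finset ℕ}
    (hT : T ∈ (admList m k w).powerset) (hi : i < k) : i ∉ T := fun h => by
  have := ((mem_admList m k w i).1 (Finset.mem_powerset.1 hT h)).1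
  omega

theorem mixSum_cons (x : ℕ → A) (m k a : ℕ) (w : List ℕ)
    (h : ∀ b ∈ w.head?, ¬ (a < m ∧ m ≤ b)) :
    mixSum C wt x m k (a :: w) = cons C (x a) (mixSum C wt x m (k + 1) w) := by
  have e : admList m k (a :: w) = admList m (k + 1) w := by
    cases w with
    | nil => rfl
    | cons b w => rw [admList, if_neg (h b (by simp))]
  rw [mixSum, mixSum, e, map_sum]
  refine Finset.sum_congr rfl fun T hT => ?_
  rw [List.map_cons, contract_of_notMem (notMem_of_subset_admList hT (by omega)), word, map_smul]

theorem mixSum_cons_cons (x : ℕ → A) (m k a b : ℕ) (w : List ℕ) (ha : a < m) (hb : m ≤ b) :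
    mixSum C wt x m k (a :: b :: w) =
      cons C (x a) (mixSum C wt x m (k + 1) (b :: w)) +
        wt • cons C (x a * x b) (mixSum C wt x m (k + 2) w) := by
  have e : admList m (k + 1) (b :: w) = admList m (k + 2) w := by
    cases w with
    | nil => rfl
    | cons c w => rw [admList, if_neg (by omega)]
  have hk : k ∉ admList m (k + 1) (b :: w) := fun h => by
    have := ((mem_admList _ _ _ _).1 h).1
    omega
  rw [mixSum, admList, if_pos ⟨ha, hb⟩, Finset.sum_powerset_insert hk]
  congr 1
  · rw [mixSum, map_sum]
    refine Finset.sum_congr rfl fun T hT => ?_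
    rw [List.map_cons, contract_of_notMem (notMem_of_subset_admList hT (by omega)), word, map_smul]
  · rw [mixSum, e, map_sum, Finset.smul_sum]
    refine Finset.sum_congr rfl fun T hT => ?_
    have h0 := notMem_of_subset_admList hT (show k < k + 2 by omega)
    have h1 := notMem_of_subset_admList hT (show k + 1 < k + 2 by omega)
    rw [Finset.card_insert_of_notMem h0, List.map_cons, List.map_cons, contract,
      if_pos (Finset.mem_insert_self _ _), contract_of_notMem (by simp [h1]), word, map_smul,
      contract_congr (S := insert k T) (T := T) (k + 1 + 1), pow_succ', mul_smul]
    intro i hi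
    rw [Finset.mem_insert]
    exact or_iff_right (by omega)

theorem mixSum_left (x : ℕ → A) (m : ℕ) : ∀ (k : ℕ) (w : List ℕ), (∀ a ∈ w, a < m) →
    mixSum C wt x m k w = word C (w.map x)
  | k, [], _ => by simp [mixSum_nil, word]
  | k, a :: w, h => by
    rw [mixSum_cons, mixSum_left x m (k + 1) w fun b hb => h b (by simp [hb]), List.map_cons, word]
    intro b hb
    have := h b (List.mem_cons_of_mem _ (List.mem_of_mem_head? hb))
    omega

theorem mixSum_right (x : ℕ → A) (m : ℕ) : ∀ (k : ℕ) (w : List ℕ), (∀ a ∈ w, m ≤ a) →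
    mixSum C wt x m k w = word C (w.map x)
  | k, [], _ => by simp [mixSum_nil, word]
  | k, a :: w, h => by
    rw [mixSum_cons, mixSum_right x m (k + 1) w fun b hb => h b (by simp [hb]), List.map_cons, word]
    intro b hb
    have := h a (by simp)
    omega

theorem sum_map_cons_left (x : ℕ → A) (m k a b : ℕ) (l l' : List ℕ) (ha : a < m) (hb : m ≤ b)
    (hl : ∀ a ∈ l, a < m) :
    (((interleavings l (b :: l')).map (a :: ·)).map (mixSum C wt x m k)).sum =
      cons C (x a) (((interleavings l (b :: l')).map (mixSum C wt x m (k + 1))).sum) +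
        wt • cons C (x a * x b) (((interleavings l l').map (mixSum C wt x m (k + 2))).sum) := by
  have key : ∀ L : List (List ℕ), ((L.map (a :: ·)).map (mixSum C wt x m k)).sum =
      (L.map fun w => mixSum C wt x m k (a :: w)).sum := fun L => by
    rw [List.map_map]; rfl
  have hB : ∀ L : List (List ℕ), (((L.map (b :: ·)).map (a :: ·)).map (mixSum C wt x m k)).sum =
      cons C (x a) (((L.map (b :: ·)).map (mixSum C wt x m (k + 1))).sum) +
        wt • cons C (x a * x b) ((L.map (mixSum C wt x m (k + 2))).sum) := fun L => by
    induction L with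
    | nil => simp
    | cons w L ih =>
      simp only [List.map_cons, List.sum_cons, map_add, ih, smul_add,
        mixSum_cons_cons C wt x m k a b w ha hb]
      abel
  have hA : ∀ (a' : ℕ) (_ : a' < m) (L : List (List ℕ)),
      (((L.map (a' :: ·)).map (a :: ·)).map (mixSum C wt x m k)).sum =
      cons C (x a) (((L.map (a' :: ·)).map (mixSum C wt x m (k + 1))).sum) := fun a' h L => by
    induction L with
    | nil => simp
    | cons w L ih =>
      simp only [List.map_cons, List.sum_cons, map_add, ih]
      rw [mixSum_cons C wt x m k a (a' :: w) (by simp; omega)]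
  cases l with
  | nil => simpa [interleavings] using hB [l']
  | cons a' l =>
    have ha' : a' < m := hl a' (by simp)
    rw [interleavings, List.map_append, List.map_append, List.map_append, List.sum_append,
      List.sum_append, hA a' ha', hB, map_add, add_assoc]

theorem sum_interleavings (x : ℕ → A) (m : ℕ) : ∀ (k : ℕ) (l l' : List ℕ), (∀ a ∈ l, a < m) →
    (∀ b ∈ l', m ≤ b) → ((interleavings l l').map (mixSum C wt x m k)).sum =
      shuffle C A wt (word C (l.map x)) (word C (l'.map x))
  | k, [], l', _, hl' => by
    simp [interleavings, word, emptyWord_shuffle, mixSum_right C wt x m k l' hl']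
  | k, a :: l, [], hl, _ => by
    rw [List.map_nil, word.eq_1 C, shuffle_emptyWord]
    simp [interleavings, mixSum_left C wt x m k (a :: l) hl]
  | k, a :: l, b :: l', hl, hl' => by
    have ha : a < m := hl a (by simp)
    have hb : m ≤ b := hl' b (by simp)
    have hl1 : ∀ a ∈ l, a < m := fun c hc => hl c (by simp [hc])
    have hl2 : ∀ a ∈ l', m ≤ a := fun c hc => hl' c (by simp [hc])
    have h1 := sum_interleavings x m (k + 1) l (b :: l') hl1 hl'
    have h2 := sum_interleavings x m (k + 1) (a :: l) l' hl hl2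
    have h3 := sum_interleavings x m (k + 2) l l' hl1 hl2
    have hB : ∀ L : List (List ℕ), ((L.map (b :: ·)).map (mixSum C wt x m k)).sum =
        cons C (x b) ((L.map (mixSum C wt x m (k + 1))).sum) := fun L => by
      induction L with
      | nil => simp
      | cons w L ih =>
        simp only [List.map_cons, List.sum_cons, map_add, ih]
        rw [mixSum_cons C wt x m k b w (by intros; omega)]
    rw [interleavings, List.map_append, List.sum_append,
      sum_map_cons_left C wt x m k a b l l' ha hb hl1, hB, h1, h2, h3]
    simp only [List.map_cons, word, cons_shuffle_cons]
    abel
  termination_by k l l' => l.length + l'.length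

theorem admList_ofFn (m n : ℕ) (σ : Equiv.Perm (Fin (m + n))) :
    admList m 0 (List.ofFn fun k => (σ k : ℕ)) = admissible m n σ := by
  ext i
  simp only [mem_admList, admissible, Finset.mem_filter, Finset.mem_range, Nat.sub_zero,
    List.length_ofFn, List.getElem_ofFn, Nat.zero_le, true_and]
  constructor
  · rintro ⟨h, h'⟩
    exact ⟨by omega, h, h'⟩
  · rintro ⟨-, h, h'⟩
    exact ⟨h, h'⟩

/-- The product of words is the sum over all mixable shuffles `(σ, T)`. -/
theorem shuffle_word_ofFn (m n : ℕ) (x : Fin m → A) (y : Fin n → A) :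
    shuffle C A wt (word C (List.ofFn x)) (word C (List.ofFn y)) =
      ∑ σ ∈ shuffles m n, ∑ T ∈ (admissible m n σ).powerset,
        wt ^ T.card • word C (contract T 0 (List.ofFn fun k => Fin.append x y (σ k))) := by
  let z : ℕ → A := fun k => if h : k < m + n then Fin.append x y ⟨k, h⟩ else 0
  have hx : (List.range m).map z = List.ofFn x := by
    apply List.ext_getElem
    · simp
    · intro i h1 h2
      have hi : i < m := by simpa using h1
      have : Fin.append x y ⟨i, by omega⟩ = x ⟨i, hi⟩ := Fin.append_left x y ⟨i, hi⟩
      simp [z, this, show i < m + n by omega]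
  have hy : (List.range' m n).map z = List.ofFn y := by
    apply List.ext_getElem
    · simp
    · intro i h1 h2
      have hi : i < n := by simpa using h1
      have : Fin.append x y ⟨m + i, by omega⟩ = y ⟨i, hi⟩ := Fin.append_right x y ⟨i, hi⟩
      simp [z, this, hi]
  rw [← hx, ← hy, ← sum_interleavings C wt z m 0 _ _ (by simp) (by simp +contextual), ← sum_shuffles]
  refine Finset.sum_congr rfl fun σ _ => ?_
  rw [mixSum, admList_ofFn]
  refine Finset.sum_congr rfl fun T _ => ?_
  rw [List.map_ofFn]
  congr 3
  refine congrArg List.ofFn (funext fun k => ?_)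
  simp [z]

end MixableShuffles

section ShaAlgebra

variable (C : Type u) [CommRing C] (wt : C) (A : Type v) [CommRing A] [Algebra C A]

/-- The underlying module `⨁_{k ≥ 0} A^{⊗ (k+1)}` of the shuffle Baxter algebra on `A` of
weight `wt`. -/
def Sha (_wt : C) (A : Type v) [CommRing A] [Algebra C A] : Type (max u v) :=
  ⨁ k : ℕ, ⨂[C]^(k + 1) A

namespace Sha

instance : AddCommGroup (Sha C wt A) :=
  inferInstanceAs (AddCommGroup (⨁ k : ℕ, ⨂[C]^(k + 1) A))

instance : Module C (Sha C wt A) :=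
  inferInstanceAs (Module C (⨁ k : ℕ, ⨂[C]^(k + 1) A))

/-- The inclusion of the summand `A^{⊗ (k+1)}`. -/
def incl (k : ℕ) : (⨂[C]^(k + 1) A) →ₗ[C] Sha C wt A :=
  DirectSum.lof C ℕ (fun k => ⨂[C]^(k + 1) A) k

variable {C wt A} in
theorem hom_ext {M : Type*} [AddCommGroup M] [Module C M] {f g : Sha C wt A →ₗ[C] M}
    (h : ∀ k, f ∘ₗ incl C wt A k = g ∘ₗ incl C wt A k) : f = g :=
  DirectSum.linearMap_ext (R := C) (M := fun k => ⨂[C]^(k + 1) A) h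

/-- The linear map out of the direct sum with given components. -/
def desc {M : Type*} [AddCommGroup M] [Module C M] (f : ∀ k, (⨂[C]^(k + 1) A) →ₗ[C] M) :
    Sha C wt A →ₗ[C] M :=
  DirectSum.toModule C ℕ M f

@[simp]
theorem desc_incl {M : Type*} [AddCommGroup M] [Module C M]
    (f : ∀ k, (⨂[C]^(k + 1) A) →ₗ[C] M) (k : ℕ) (x : ⨂[C]^(k + 1) A) :
    desc C wt A f (incl C wt A k x) = f k x :=
  DirectSum.toModule_lof (R := C) (M := fun k => ⨂[C]^(k + 1) A) (φ := f) k x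

/-- The bilinear map `(x₀, x⁺) ↦ x₀ ⊗ x⁺`. -/
def mk : A →ₗ[C] Words C A →ₗ[C] Sha C wt A :=
  LinearMap.flip (DirectSum.toModule C ℕ _ fun k =>
    ((consPow C k).compr₂ (incl C wt A k)).flip)

theorem mk_lof (a : A) (k : ℕ) (w : ⨂[C]^k A) :
    mk C wt A a (DirectSum.lof C ℕ (fun k => ⨂[C]^k A) k w) = incl C wt A k (consPow C k a w) := by
  simp [mk]

theorem incl_tprod (k : ℕ) (x : Fin (k + 1) → A) :
    incl C wt A k (PiTensorProduct.tprod C x) =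
      mk C wt A (x 0) (word C (List.ofFn (Fin.tail x))) := by
  rw [word_ofFn, mk_lof, tprod_succ]

/-- The identification `A ⊗ ⨁_k A^{⊗ k} ≅ ⨁_k A^{⊗ (k+1)}`. -/
def split : Sha C wt A ≃ₗ[C] A ⊗[C] Words C A :=
  LinearEquiv.ofLinearMap
    (desc C wt A fun k => uncons C k
      ((TensorProduct.mk C A (Words C A)).compl₂ (DirectSum.lof C ℕ (fun k => ⨂[C]^k A) k)))
    (TensorProduct.lift (mk C wt A))
    (by
      apply TensorProduct.ext
      apply LinearMap.ext
      intro a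
      apply DirectSum.linearMap_ext
      intro k
      apply LinearMap.ext
      intro w
      simp [mk_lof, uncons_consPow])
    (by
      apply hom_ext
      intro k
      apply PiTensorProduct.ext
      ext x
      simp only [LinearMap.compMultilinearMap_apply, LinearMap.comp_apply, desc_incl, tprod_succ,
        uncons_consPow, LinearMap.compl₂_apply, TensorProduct.mk_apply, TensorProduct.lift.tmul,
        mk_lof, LinearMap.id_apply])

@[simp]
theorem split_symm_tmul (a : A) (w : Words C A) :
    (split C wt A).symm (a ⊗ₜ w) = mk C wt A a w := by
  simp [split]

@[simp]
theorem split_mk (a : A) (w : Words C A) : split C wt A (mk C wt A a w) = a ⊗ₜ w := by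
  rw [← split_symm_tmul, LinearEquiv.apply_symm_apply]

variable {C wt A} in
theorem induction {p : Sha C wt A → Prop} (x : Sha C wt A) (hmk : ∀ a w, p (mk C wt A a w))
    (hadd : ∀ x y, p x → p y → p (x + y)) : p x := by
  obtain ⟨t, rfl⟩ := (split C wt A).symm.surjective x
  induction t using TensorProduct.induction_on with
  | zero => simpa using hmk 0 0
  | tmul a w => simpa using hmk a w
  | add s t hs ht => rw [map_add]; exact hadd _ _ hs ht

/-- The mixable shuffle product, as a bilinear map: the product of `x₀ ⊗ x⁺` and `y₀ ⊗ y⁺` is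
`x₀ y₀ ⊗ (x⁺ ⧢ y⁺)`. -/
def mulHom : Sha C wt A →ₗ[C] Sha C wt A →ₗ[C] Sha C wt A :=
  ((TensorProduct.map₂ (LinearMap.mul C A) (shuffle C A wt)).compl₁₂ (split C wt A).toLinearMap
    (split C wt A).toLinearMap).compr₂ (split C wt A).symm.toLinearMap

instance : Mul (Sha C wt A) := ⟨fun x y => mulHom C wt A x y⟩

instance : One (Sha C wt A) := ⟨mk C wt A 1 (emptyWord C A)⟩

theorem one_def : (1 : Sha C wt A) = mk C wt A 1 (emptyWord C A) := rfl

theorem mul_def (x y : Sha C wt A) : x * y = mulHom C wt A x y := rfl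

theorem mk_mul_mk (a b : A) (u v : Words C A) :
    mk C wt A a u * mk C wt A b v = mk C wt A (a * b) (shuffle C A wt u v) := by
  simp [mul_def, mulHom]

/-- The pure tensor `a ⊗ l₁ ⊗ ⋯ ⊗ lₖ`, in the summand `A^{⊗ (k+1)}`. -/
def pure (a : A) (l : List A) : Sha C wt A :=
  incl C wt A l.length (PiTensorProduct.tprod C (Fin.cons a l.get : Fin (l.length + 1) → A))

theorem pure_eq_mk (a : A) (l : List A) : pure C wt A a l = mk C wt A a (word C l) := by
  rw [pure, incl_tprod, Fin.tail_cons, Fin.cons_zero, List.ofFn_get]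

/-- The product of pure tensors is
`∑ wt^{|T|} x₀ y₀ ⊗ σ(x⁺ ⊗ y⁺; T)`, summed over all mixable shuffles `(σ, T)`. -/
theorem incl_mul_incl (m n : ℕ) (x : Fin (m + 1) → A) (y : Fin (n + 1) → A) :
    incl C wt A m (PiTensorProduct.tprod C x) * incl C wt A n (PiTensorProduct.tprod C y) =
      ∑ σ ∈ shuffles m n, ∑ T ∈ (admissible m n σ).powerset,
        wt ^ T.card • pure C wt A (x 0 * y 0)
          (contract T 0 (List.ofFn fun k => Fin.append (Fin.tail x) (Fin.tail y) (σ k))) := by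
  rw [incl_tprod, incl_tprod, mk_mul_mk, shuffle_word_ofFn]
  simp only [map_sum, map_smul, pure_eq_mk]

theorem mul_comm' (x y : Sha C wt A) : x * y = y * x := by
  induction x using induction with
  | hmk a u =>
    induction y using induction with
    | hmk b v => rw [mk_mul_mk, mk_mul_mk, mul_comm, shuffle_comm]
    | hadd x y hx hy => simp only [mul_def, map_add, LinearMap.add_apply] at *; rw [hx, hy]
  | hadd x y hx hy => simp only [mul_def, map_add, LinearMap.add_apply] at *; rw [hx, hy]

theorem mul_assoc' (x y z : Sha C wt A) : x * y * z = x * (y * z) := by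
  induction x using induction with
  | hmk a u =>
    induction y using induction with
    | hmk b v =>
      induction z using induction with
      | hmk c w => simp only [mk_mul_mk, mul_assoc, shuffle_assoc]
      | hadd x y hx hy => simp only [mul_def, map_add, LinearMap.add_apply] at *; rw [hx, hy]
    | hadd x y hx hy => simp only [mul_def, map_add, LinearMap.add_apply] at *; rw [hx, hy]
  | hadd x y hx hy => simp only [mul_def, map_add, LinearMap.add_apply] at *; rw [hx, hy]

theorem one_mul' (x : Sha C wt A) : 1 * x = x := by
  induction x using induction with
  | hmk a u => rw [one_def, mk_mul_mk, one_mul, emptyWord_shuffle]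
  | hadd x y hx hy => simp only [mul_def, map_add] at *; rw [hx, hy]

instance : CommRing (Sha C wt A) :=
  { (inferInstance : AddCommGroup (Sha C wt A)) with
    mul := (· * ·)
    one := 1
    mul_assoc := mul_assoc' C wt A
    mul_comm := mul_comm' C wt A
    one_mul := one_mul' C wt A
    mul_one := fun x => by rw [mul_comm', one_mul']
    left_distrib := fun x y z => by simp only [mul_def, map_add]
    right_distrib := fun x y z => by simp only [mul_def, map_add, LinearMap.add_apply]
    zero_mul := fun x => by simp only [mul_def, map_zero, LinearMap.zero_apply]
    mul_zero := fun x => by simp only [mul_def, map_zero] }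

instance : Algebra C (Sha C wt A) :=
  Algebra.ofModule (fun c x y => by simp only [mul_def, map_smul, LinearMap.smul_apply])
    (fun c x y => by simp only [mul_def, map_smul])

/-- The Baxter operator `x₀ ⊗ ⋯ ⊗ xₖ ↦ 1 ⊗ x₀ ⊗ ⋯ ⊗ xₖ`. -/
def op : Sha C wt A →ₗ[C] Sha C wt A :=
  desc C wt A fun k => incl C wt A (k + 1) ∘ₗ consPow C (k + 1) 1

theorem op_mk (a : A) (w : Words C A) : op C wt A (mk C wt A a w) = mk C wt A 1 (cons C a w) := by
  suffices h : op C wt A ∘ₗ mk C wt A a = mk C wt A 1 ∘ₗ cons C a from LinearMap.congr_fun h w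
  apply DirectSum.linearMap_ext
  intro k
  apply LinearMap.ext
  intro w
  simp [op, mk_lof, cons_lof]

theorem op_mul_op (x y : Sha C wt A) :
    op C wt A x * op C wt A y =
      op C wt A (x * op C wt A y) + op C wt A (y * op C wt A x) + wt • op C wt A (x * y) := by
  induction x using induction with
  | hmk a u =>
    induction y using induction with
    | hmk b v =>
      simp only [op_mk, mk_mul_mk, mul_one, cons_shuffle_cons, map_add, map_smul]
      rw [shuffle_comm C wt v]
    | hadd x y hx hy =>
      simp only [map_add, mul_add, add_mul, hx, hy, smul_add]
      abel
  | hadd x y hx hy =>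
    simp only [map_add, mul_add, add_mul, hx, hy, smul_add]
    abel

variable {A} {B : Type v} [CommRing B] [Algebra C B]

/-- The linear map `⨁_k f^{⊗ (k+1)}`. -/
def mapLinear (f : A →ₐ[C] B) : Sha C wt A →ₗ[C] Sha C wt B :=
  desc C wt A fun k => incl C wt B k ∘ₗ PiTensorProduct.map fun _ => f.toLinearMap

theorem mapLinear_incl (f : A →ₐ[C] B) (k : ℕ) (x : Fin (k + 1) → A) :
    mapLinear C wt f (incl C wt A k (PiTensorProduct.tprod C x)) =
      incl C wt B k (PiTensorProduct.tprod C fun i => f (x i)) := by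
  simp [mapLinear]

/-- `f` applied to every letter of a word. -/
def wordsMap (f : A →ₐ[C] B) : Words C A →ₗ[C] Words C B :=
  DirectSum.lmap fun _ => PiTensorProduct.map fun _ => f.toLinearMap

theorem wordsMap_word (f : A →ₐ[C] B) (l : List A) :
    wordsMap C f (word C l) = word C (l.map f) := by
  obtain ⟨n, x, rfl⟩ : ∃ (n : ℕ) (x : Fin n → A), List.ofFn x = l :=
    ⟨l.length, l.get, List.ofFn_get l⟩
  rw [List.map_ofFn, word_ofFn, word_ofFn, wordsMap, DirectSum.lmap_lof, PiTensorProduct.map_tprod]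
  rfl

theorem wordsMap_cons (f : A →ₐ[C] B) (a : A) (w : Words C A) :
    wordsMap C f (cons C a w) = cons C (f a) (wordsMap C f w) := by
  suffices h : wordsMap C f ∘ₗ cons C a = cons C (f a) ∘ₗ wordsMap C f from
    LinearMap.congr_fun h w
  apply words_hom_ext
  intro l
  have := wordsMap_word C f (a :: l)
  simpa only [LinearMap.comp_apply, wordsMap_word, List.map_cons, word] using this

theorem mapLinear_mk (f : A →ₐ[C] B) (a : A) (w : Words C A) :
    mapLinear C wt f (mk C wt A a w) = mk C wt B (f a) (wordsMap C f w) := by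
  suffices h : mapLinear C wt f ∘ₗ mk C wt A a = mk C wt B (f a) ∘ₗ wordsMap C f from
    LinearMap.congr_fun h w
  apply words_hom_ext
  intro l
  obtain ⟨n, x, rfl⟩ : ∃ (n : ℕ) (x : Fin n → A), List.ofFn x = l :=
    ⟨l.length, l.get, List.ofFn_get l⟩
  have := mapLinear_incl C wt f n (Fin.cons a x)
  simp only [incl_tprod, Fin.tail_cons, Fin.cons_zero] at this
  simp only [LinearMap.comp_apply, wordsMap_word, List.map_ofFn]
  rw [this]
  rfl

theorem wordsMap_shuffle_word (f : A →ₐ[C] B) : ∀ k l : List A,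
    wordsMap C f (shuffle C A wt (word C k) (word C l)) =
      shuffle C B wt (word C (k.map f)) (word C (l.map f))
  | [], l => by rw [List.map_nil, word, word, emptyWord_shuffle, emptyWord_shuffle, wordsMap_word]
  | _ :: _, [] => by
    rw [List.map_nil, word.eq_1 C, word.eq_1 C, shuffle_emptyWord, shuffle_emptyWord, wordsMap_word]
  | a :: k, b :: l => by
    have h1 := wordsMap_shuffle_word f k (b :: l)
    have h2 := wordsMap_shuffle_word f (a :: k) l
    have h3 := wordsMap_shuffle_word f k l
    simp only [List.map_cons, word] at h1 h2 ⊢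
    simp only [cons_shuffle_cons, map_add, map_smul, wordsMap_cons, h1, h2, h3, map_mul]
  termination_by k l => k.length + l.length

theorem wordsMap_shuffle (f : A →ₐ[C] B) (u v : Words C A) :
    wordsMap C f (shuffle C A wt u v) = shuffle C B wt (wordsMap C f u) (wordsMap C f v) := by
  induction u using words_induction with
  | hw k =>
    induction v using words_induction with
    | hw l => rw [wordsMap_shuffle_word, wordsMap_word, wordsMap_word]
    | hadd u v hu hv => simp only [map_add, hu, hv]
    | hsmul c u hu => simp only [map_smul, hu]
  | hadd u v hu hv => simp only [map_add, LinearMap.add_apply, hu, hv]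
  | hsmul c u hu => simp only [map_smul, LinearMap.smul_apply, hu]

/-- The algebra homomorphism `⨁_k f^{⊗ (k+1)}` induced by `f`. -/
def map (f : A →ₐ[C] B) : Sha C wt A →ₐ[C] Sha C wt B :=
  AlgHom.ofLinearMap (mapLinear C wt f)
    (by
      have h := wordsMap_word C f []
      rw [List.map_nil, word, word] at h
      rw [one_def, one_def, mapLinear_mk, map_one, h])
    (fun x y => by
      induction x using induction with
      | hmk a u =>
        induction y using induction with
        | hmk b v => simp only [mk_mul_mk, mapLinear_mk, map_mul, wordsMap_shuffle]
        | hadd x y hx hy => simp only [mul_add, map_add, hx, hy]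
      | hadd x y hx hy => simp only [add_mul, map_add, hx, hy])

theorem map_apply (f : A →ₐ[C] B) (x : Sha C wt A) : map C wt f x = mapLinear C wt f x := rfl

theorem map_incl (f : A →ₐ[C] B) (k : ℕ) (x : Fin (k + 1) → A) :
    map C wt f (incl C wt A k (PiTensorProduct.tprod C x)) =
      incl C wt B k (PiTensorProduct.tprod C fun i => f (x i)) :=
  mapLinear_incl C wt f k x

theorem map_op (f : A →ₐ[C] B) (x : Sha C wt A) :
    map C wt f (op C wt A x) = op C wt B (map C wt f x) := by
  induction x using induction with
  | hmk a w => simp only [map_apply, op_mk, mapLinear_mk, map_one, wordsMap_cons]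
  | hadd x y hx hy => simp only [map_add, hx, hy]

variable {C wt} in
theorem algHom_ext {R : Type*} [CommRing R] [Algebra C R] {f g : Sha C wt A →ₐ[C] R}
    (h : ∀ (k : ℕ) (x : Fin (k + 1) → A),
      f (incl C wt A k (PiTensorProduct.tprod C x)) =
        g (incl C wt A k (PiTensorProduct.tprod C x))) : f = g := by
  apply AlgHom.toLinearMap_injective
  apply hom_ext
  intro k
  apply PiTensorProduct.ext
  ext x
  exact h k x

theorem map_id : map C wt (AlgHom.id C A) = AlgHom.id C (Sha C wt A) :=
  algHom_ext fun k x => map_incl C wt (AlgHom.id C A) k x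

theorem map_comp {D : Type v} [CommRing D] [Algebra C D] (g : B →ₐ[C] D) (f : A →ₐ[C] B) :
    map C wt (g.comp f) = (map C wt g).comp (map C wt f) :=
  algHom_ext fun k x => by
    rw [AlgHom.comp_apply, map_incl, map_incl, map_incl]
    rfl

/-- The Baxter operator on pure tensors. -/
theorem op_incl (k : ℕ) (x : Fin (k + 1) → A) :
    op C wt A (incl C wt A k (PiTensorProduct.tprod C x)) =
      incl C wt A (k + 1) (PiTensorProduct.tprod C (Fin.cons 1 x : Fin (k + 2) → A)) := by
  rw [op, desc_incl, LinearMap.comp_apply, consPow_tprod]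

end Sha
end ShaAlgebra

/-- A Baxter `C`-algebra of weight `wt`: a commutative `C`-algebra with a `C`-linear Baxter
operator of weight `wt`. -/
structure BaxCat (C : Type u) [CommRing C] (wt : C) where
  /-- The underlying type. -/
  carrier : Type v
  [commRing : CommRing carrier]
  [algebra : Algebra C carrier]
  /-- The Baxter operator. -/
  op : carrier →ₗ[C] carrier
  op_mul_op : ∀ x y, op x * op y = op (x * op y) + op (y * op x) + wt • op (x * y)

namespace BaxCat

attribute [instance] commRing algebra

variable {C : Type u} [CommRing C] {wt : C}

/-- Homomorphisms of Baxter algebras. -/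
@[ext]
structure Hom (R S : BaxCat.{u, v} C wt) where
  /-- The underlying algebra homomorphism. -/
  alg : R.carrier →ₐ[C] S.carrier
  map_op : ∀ x, alg (R.op x) = S.op (alg x)

/-- The category of Baxter `C`-algebras of weight `wt`. -/
instance : Category (BaxCat.{u, v} C wt) where
  Hom := Hom
  id R := ⟨AlgHom.id C R.carrier, fun _ => rfl⟩
  comp f g := ⟨g.alg.comp f.alg, fun x => by simp [f.map_op, g.map_op]⟩

@[ext]
theorem hom_ext {R S : BaxCat.{u, v} C wt} {f g : R ⟶ S} (h : f.alg = g.alg) : f = g :=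
  Hom.ext h

end BaxCat

/-- The shuffle Baxter algebra functor `A ↦ (Sha A, op)`, `f ↦ ⨁_k f^{⊗ (k+1)}`. -/
def shaFunctor (C : Type u) [CommRing C] (wt : C) : CommAlgCat.{u} C ⥤ BaxCat.{u, u} C wt where
  obj A := { carrier := Sha C wt A, op := Sha.op C wt A, op_mul_op := Sha.op_mul_op C wt A }
  map f := { alg := Sha.map C wt f.hom, map_op := Sha.map_op C wt f.hom }
  map_id A := BaxCat.hom_ext (Sha.map_id C wt)
  map_comp f g := BaxCat.hom_ext (Sha.map_comp C wt g.hom f.hom)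

end Baxter

end

open CategoryTheory Limits TensorProduct DirectSum

noncomputable section

/-! The functor `shaFunctor` is left adjoint to the functor forgetting the Baxter operator, and left
adjoints preserve colimits. Everything therefore rests on a universal property: an algebra
homomorphism f : A → R into a Baxter algebra (R, P) extends uniquely to a Baxter homomorphism Ш(A) →
R.

Uniqueness (`Sha.baxterHom_ext`): for k ≥ 1, x₀ ⊗ x₁ ⊗ ⋯ ⊗ xₖ is the product of x₀ and P_A(x₁ ⊗ ⋯ ⊗
xₖ), so A generates Ш(A) under the algebra operations and P_A. This forces the formula x₀ ⊗ ⋯ ⊗ xₖ ↦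
f x₀ · P(f x₁ · P(f x₂ ⋯ P(f xₖ))).

Existence (`Sha.lift`): the formula is compatible with the operators because P_A only puts a 1 in
front. The real content is multiplicativity, which reduces to `evalWords_shuffle`: sorted by first
letter, the mixable shuffle product has three terms, and evaluation sends them to the three terms of
the Baxter identity for P.

Colimits of Baxter algebras need no construction of their own: commutative algebras have colimits,
with the tensor product as binary coproduct, and the functor transports them. -/

namespace Baxter

/-! ### Evaluating words in a Baxter algebra -/

section Lift

variable {C : Type u} [CommRing C] {wt : C} {A : Type v} [CommRing A] [Algebra C A]
  {R : Type*} [CommRing R] [Algebra C R]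

/-- The linear map `a₁ ⊗ ⋯ ⊗ aₙ ↦ P (f a₁ * P (f a₂ * ⋯ P (f aₙ)))` on the `n`-th tensor power. -/
def evalPow (P : R →ₗ[C] R) (f : A →ₐ[C] R) : (n : ℕ) → (⨂[C]^n A) →ₗ[C] R
  -- The zeroth tensor power is C, and c goes to c • 1. The empty word thus has value 1, so that a
  -- one-letter tensor x₀ will later be sent to f x₀.
  | 0 => LinearMap.toSpanSingleton C R 1 ∘ₗ
      (PiTensorProduct.isEmptyEquiv (R := C) (s := fun _ : Fin 0 => A) (Fin 0)).toLinearMap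
  -- `P` is applied on the outside even for a single letter: a word here is the tail x₁ ⊗ ⋯ ⊗ xₙ,
  -- which in Ш(A) stands behind a letter x₀ that lies outside all operators.
  | n + 1 => uncons C n
      (((LinearMap.mul C R).compl₁₂ f.toLinearMap (evalPow P f n)).compr₂ P)

/-- The linear map `a₁ ⊗ ⋯ ⊗ aₙ ↦ P (f a₁ * P (f a₂ * ⋯ P (f aₙ)))` on words. -/
def evalWords (P : R →ₗ[C] R) (f : A →ₐ[C] R) : Words C A →ₗ[C] R :=
  DirectSum.toModule C ℕ R (evalPow P f)

theorem evalWords_emptyWord (P : R →ₗ[C] R) (f : A →ₐ[C] R) :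
    evalWords P f (emptyWord C A) = 1 := by
  simp [evalWords, emptyWord, evalPow]

/-- Together with the value at the empty word, this recursion determines the evaluation; later
arguments use only these two facts and linearity. -/
theorem evalWords_cons (P : R →ₗ[C] R) (f : A →ₐ[C] R) (a : A) (w : Words C A) :
    evalWords P f (cons C a w) = P (f a * evalWords P f w) := by
  suffices h : evalWords P f ∘ₗ cons C a = P ∘ₗ LinearMap.mulLeft C (f a) ∘ₗ evalWords P f from
    LinearMap.congr_fun h w
  apply DirectSum.linearMap_ext
  intro n
  apply LinearMap.ext
  intro w
  simp [cons_lof, evalWords, evalPow, uncons_consPow]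

/-- `P` is a Baxter operator of weight `wt`. -/
def IsBaxterOperator (wt : C) (P : R →ₗ[C] R) : Prop :=
  ∀ x y, P x * P y = P (x * P y) + P (y * P x) + wt • P (x * y)

/-- The heart of the proof. Let E be the evaluation, x = f a · E(k) and y = f b · E(l). By
induction, the shuffles starting with a, with b and with ab evaluate to P(x P(y)), P(y P(x)) and
P(xy), the last with the weight as coefficient. Their sum is P(x) P(y) by the Baxter identity, which
is the product of the evaluations of the two words. -/
theorem evalWords_shuffle_word {P : R →ₗ[C] R} (hP : IsBaxterOperator wt P) (f : A →ₐ[C] R) :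
    ∀ k l : List A, evalWords P f (shuffle C A wt (word C k) (word C l)) =
      evalWords P f (word C k) * evalWords P f (word C l)
  | [], l => by rw [word, emptyWord_shuffle, evalWords_emptyWord, one_mul]
  | _ :: _, [] => by rw [word.eq_1 C, shuffle_emptyWord, evalWords_emptyWord, mul_one]
  | a :: k, b :: l => by
    have h1 := evalWords_shuffle_word hP f k (b :: l)
    have h2 := evalWords_shuffle_word hP f (a :: k) l
    have h3 := evalWords_shuffle_word hP f k l
    simp only [word] at h1 h2 ⊢
    simp only [cons_shuffle_cons, map_add, map_smul, evalWords_cons, h1, h2, h3, map_mul]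
    -- The Baxter identity expands the product on the right; the summands then match one by one up
    -- to the order of factors in the commutative ring `R`.
    rw [hP]
    congr 3 <;> ring_nf
  termination_by k l => k.length + l.length

theorem evalWords_shuffle {P : R →ₗ[C] R} (hP : IsBaxterOperator wt P) (f : A →ₐ[C] R)
    (u v : Words C A) :
    evalWords P f (shuffle C A wt u v) = evalWords P f u * evalWords P f v := by
  induction u using words_induction with
  | hw k =>
    induction v using words_induction with
    | hw l => exact evalWords_shuffle_word hP f k l
    | hadd u v hu hv => simp only [map_add, mul_add, hu, hv]
    | hsmul c u hu => simp only [map_smul, mul_smul_comm, hu]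
  | hadd u v hu hv => simp only [map_add, LinearMap.add_apply, add_mul, hu, hv]
  | hsmul c u hu => simp only [map_smul, LinearMap.smul_apply, smul_mul_assoc, hu]

/-! ### The universal property of the shuffle Baxter algebra -/

namespace Sha

/-- The linear map `a ⊗ w ↦ f a * evalWords P f w`. -/
def liftLinear (wt : C) (P : R →ₗ[C] R) (f : A →ₐ[C] R) : Sha C wt A →ₗ[C] R :=
  TensorProduct.lift ((LinearMap.mul C R).compl₁₂ f.toLinearMap (evalWords P f)) ∘ₗ
    (split C wt A).toLinearMap

theorem liftLinear_mk (P : R →ₗ[C] R) (f : A →ₐ[C] R) (a : A) (w : Words C A) :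
    liftLinear wt P f (mk C wt A a w) = f a * evalWords P f w := by
  simp [liftLinear]

/-- The extension of `f : A → R` to a homomorphism of Baxter algebras on the shuffle Baxter
algebra. -/
def lift {P : R →ₗ[C] R} (hP : IsBaxterOperator wt P) (f : A →ₐ[C] R) : Sha C wt A →ₐ[C] R :=
  AlgHom.ofLinearMap (liftLinear wt P f)
    (by rw [one_def, liftLinear_mk, map_one, evalWords_emptyWord, mul_one])
    (fun x y => by
      induction x using induction with
      | hmk a u =>
        induction y using induction with
        | hmk b v =>
          -- First letters multiply in A and tails shuffle, so multiplicativity of `f` and of the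
          -- evaluation give the claim after regrouping four factors.
          simp only [mk_mul_mk, liftLinear_mk, map_mul, evalWords_shuffle hP]
          ring
        | hadd x y hx hy => simp only [mul_add, map_add, hx, hy]
      | hadd x y hx hy => simp only [add_mul, map_add, hx, hy])

theorem lift_mk {P : R →ₗ[C] R} (hP : IsBaxterOperator wt P) (f : A →ₐ[C] R) (a : A)
    (w : Words C A) : lift hP f (mk C wt A a w) = f a * evalWords P f w :=
  liftLinear_mk P f a w

/-- The operator pushes the first letter into the tail, where evaluation wraps it in `P`; the new
first letter 1 contributes the factor f 1 = 1. -/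
theorem lift_op {P : R →ₗ[C] R} (hP : IsBaxterOperator wt P) (f : A →ₐ[C] R) (x : Sha C wt A) :
    lift hP f (op C wt A x) = P (lift hP f x) := by
  induction x using induction with
  | hmk a w => rw [op_mk, lift_mk, lift_mk, map_one, one_mul, evalWords_cons]
  | hadd x y hx hy => simp only [map_add, hx, hy]

variable (C wt A) in
/-- The inclusion of `A` into the shuffle Baxter algebra, as words with one letter. -/
def ι : A →ₐ[C] Sha C wt A :=
  AlgHom.ofLinearMap ((mk C wt A).flip (emptyWord C A)) rfl
    (fun x y => by
      simp only [LinearMap.flip_apply, mk_mul_mk, emptyWord_shuffle])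

theorem ι_apply (a : A) : ι C wt A a = mk C wt A a (emptyWord C A) := rfl

/-- Detaches the first letter. Since 1 ⊗ w is the unit or, for a nonempty pure tensor w, a value of
the operator, this is the step by which A generates Ш(A). -/
theorem ι_mul_mk_one (a : A) (w : Words C A) :
    ι C wt A a * mk C wt A 1 w = mk C wt A a w := by
  rw [ι_apply, mk_mul_mk, mul_one, emptyWord_shuffle]

theorem lift_ι {P : R →ₗ[C] R} (hP : IsBaxterOperator wt P) (f : A →ₐ[C] R) (a : A) :
    lift hP f (ι C wt A a) = f a := by
  rw [ι_apply, lift_mk, evalWords_emptyWord, mul_one]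

/-- The uniqueness half of the universal property. It suffices to compare the two maps on 1 ⊗ w for
pure tensors w, by induction on the length of w. -/
theorem baxterHom_ext {P : R →ₗ[C] R} {f g : Sha C wt A →ₐ[C] R}
    (hf : ∀ x, f (op C wt A x) = P (f x)) (hg : ∀ x, g (op C wt A x) = P (g x))
    (h : ∀ a, f (ι C wt A a) = g (ι C wt A a)) : f = g := by
  have key : ∀ l : List A, f (mk C wt A 1 (word C l)) = g (mk C wt A 1 (word C l)) := by
    intro l
    induction l with
    | nil => rw [word, ← one_def, map_one, map_one]
    | cons a l ih =>
      -- 1 ⊗ a ⊗ l is the operator applied to a ⊗ l, which is the product of `ι a` and 1 ⊗ l; the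
      -- latter is covered by the induction hypothesis.
      rw [word, ← op_mk, hf, hg, ← ι_mul_mk_one, map_mul f, map_mul g, ih, h]
  refine algHom_ext fun k x => ?_
  rw [incl_tprod, ← ι_mul_mk_one, map_mul, map_mul, key, h]

theorem map_ι {B : Type v} [CommRing B] [Algebra C B] (f : A →ₐ[C] B) (a : A) :
    map C wt f (ι C wt A a) = ι C wt B (f a) := by
  -- The empty list yields that `wordsMap` preserves the empty word.
  have h := wordsMap_word C f []
  rw [List.map_nil, word, word] at h
  rw [ι_apply, ι_apply, map_apply, mapLinear_mk, h]

/-- Naturality of the extension in the algebra of letters. By uniqueness, it is enough that both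
sides respect the operators and agree on A. -/
theorem lift_comp {B : Type v} [CommRing B] [Algebra C B] {P : R →ₗ[C] R}
    (hP : IsBaxterOperator wt P) (f : A →ₐ[C] B) (g : B →ₐ[C] R) :
    lift hP (g.comp f) = (lift hP g).comp (map C wt f) :=
  baxterHom_ext (lift_op hP _)
    (fun x => by rw [AlgHom.comp_apply, AlgHom.comp_apply, map_op, lift_op])
    (fun a => by rw [AlgHom.comp_apply, map_ι, lift_ι, lift_ι, AlgHom.comp_apply])

end Sha

end Lift

/-! ### The adjunction and preservation of colimits -/

/-- The functor forgetting the Baxter operator. -/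
def forgetOp (C : Type u) [CommRing C] (wt : C) : BaxCat.{u, v} C wt ⥤ CommAlgCat.{v} C where
  obj R := CommAlgCat.of C R.carrier
  map f := CommAlgCat.ofHom f.alg

/-- The shuffle Baxter algebra is the free Baxter algebra on a commutative algebra. -/
def shaAdjunction (C : Type u) [CommRing C] (wt : C) : shaFunctor C wt ⊣ forgetOp.{u, u} C wt :=
  Adjunction.mkOfHomEquiv
    { homEquiv := fun A R =>
        { toFun := fun g => CommAlgCat.ofHom (g.alg.comp (Sha.ι C wt A))
          invFun := fun f =>
            { alg := Sha.lift R.op_mul_op f.hom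
              map_op := Sha.lift_op R.op_mul_op f.hom }
          -- A Baxter homomorphism is the extension of its own restriction to A: this is uniqueness.
          -- The other inverse law says that the extension restricts to `f`.
          left_inv := fun g => BaxCat.hom_ext <|
            Sha.baxterHom_ext (Sha.lift_op R.op_mul_op _) g.map_op (Sha.lift_ι R.op_mul_op _)
          right_inv := fun f => CommAlgCat.hom_ext <| AlgHom.ext <|
            Sha.lift_ι R.op_mul_op f.hom }
      homEquiv_naturality_left_symm := fun {_ _ R} f g => BaxCat.hom_ext <|
        Sha.lift_comp R.op_mul_op f.hom g.hom
      -- Restriction to A is precomposition with `Sha.ι`, so naturality in the target is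
      -- associativity of composition, which holds definitionally.
      homEquiv_naturality_right := fun _ _ => rfl }

end Baxter

end

theorem mainTheorem10 {C : Type u} [CommRing C] (wt : C) :
    (∀ {Λ : Type u} [Category.{u} Λ] (F : Λ ⥤ CommAlgCat.{u} C),
      (∃ _ : HasColimit (F ⋙ Baxter.shaFunctor C wt),
        ∃ e : colimit (F ⋙ Baxter.shaFunctor C wt) ≅ (Baxter.shaFunctor C wt).obj (colimit F),
          ∀ i : Λ, colimit.ι (F ⋙ Baxter.shaFunctor C wt) i ≫ e.hom =
            (Baxter.shaFunctor C wt).map (colimit.ι F i)) ∧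
      ∀ c : Cocone F, IsColimit c →
        Nonempty (IsColimit ((Baxter.shaFunctor C wt).mapCocone c))) ∧
    ∀ A B : CommAlgCat.{u} C,
      Nonempty (IsColimit (BinaryCofan.mk
        ((Baxter.shaFunctor C wt).map
          (CommAlgCat.ofHom (Algebra.TensorProduct.includeLeft : A →ₐ[C] A ⊗[C] B)))
        ((Baxter.shaFunctor C wt).map
          (CommAlgCat.ofHom (Algebra.TensorProduct.includeRight : B →ₐ[C] A ⊗[C] B))))) := by
  -- Two universe sizes are needed: diagrams of shape Λ live in universe `u`, while the two-object
  -- shape of binary coproducts lives in universe 0.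
  have hu : PreservesColimitsOfSize.{u, u} (Baxter.shaFunctor C wt) :=
    (Baxter.shaAdjunction C wt).leftAdjoint_preservesColimits
  have h0 : PreservesColimitsOfSize.{0, 0} (Baxter.shaFunctor C wt) :=
    (Baxter.shaAdjunction C wt).leftAdjoint_preservesColimits
  refine ⟨fun {Λ} _ F => ⟨?_, fun c hc => ⟨isColimitOfPreserves _ hc⟩⟩, fun A B => ?_⟩
  -- The image of the colimit cocone of `F` is itself a colimit cocone; this proves that the colimit
  -- of Baxter algebras exists. Uniqueness of colimits supplies the isomorphism and its
  -- compatibility with the canonical maps.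
  · let hc := isColimitOfPreserves (Baxter.shaFunctor C wt) (colimit.isColimit F)
    have hF : HasColimit (F ⋙ Baxter.shaFunctor C wt) := ⟨⟨⟨_, hc⟩⟩⟩
    exact ⟨hF, (colimit.isColimit _).coconePointUniqueUpToIso hc, fun i =>
      (colimit.isColimit _).comp_coconePointUniqueUpToIso_hom hc i⟩
  -- A ⊗ B with its two inclusions is the coproduct of commutative algebras; the lemma also replaces
  -- the image of the cofan by the cofan of the images.
  · exact ⟨mapIsColimitOfPreservesOfIsColimit (Baxter.shaFunctor C wt) _ _
      (CommAlgCat.binaryCofanIsColimit A B)⟩
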